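/- Notation. $\bar\Phi(t)=\Pr[g\ge t]$ for $g\sim\mathcal N(0,1)$, $\mathbf r$ is a standard Gaussian vector, $\Delta(G)$ is the maximum degree and $N_G(i)$ the neighborhood of $i$ in $G$; a strict vector 3-coloring of $G=(V,E)$ is a family of unit vectors $\{\mathbf v_i\}_{i\in V}$ in some $\mathbb R^d$ with $\mathbf v_i\cdot\mathbf v_j=-\tfrac12$ for every $\{i,j\}\in E$; and $\mathbf v_{ij}=\frac{\mathbf v_j-(\mathbf v_i\cdot\mathbf v_j)\mathbf v_i}{\|\mathbf v_j-(\mathbf v_i\cdot\mathbf v_j)\mathbf v_i\|}$. The algorithm $\mathrm{KMS}'(G,\{\mathbf v_i\},t)$ samples $\mathbf r$, lets $S=\{i\in V:\mathbf r\cdot\mathbf v_i\ge t\}$, finds (by any, possibly randomized, rule) a maximal matching $M$ of the subgraph induced by $S$, and returns $S$ with all vertices of $M$ removed. It fails on $G$ with parameter $t$ if $\Pr[i\text{ is removed from }S\mid \mathbf r\cdot\mathbf v_i\ge t]\ge\frac12$ for at least half of the vertices $i$. For $c>0$, the parameter $t$ is $c$-inefficient for $G$ if $\bar\Phi(t)=\Delta(G)^{-\frac1{3(1+c)}}$.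 Let $\mu_i(j)=\Pr[\{i,j\}\in M\mid \mathbf r\cdot\mathbf v_i\ge t]$ and $\mu_i(J)=\sum_{j\in J}\mu_i(j)$ for $J\subseteq V$. A finite family of unit vectors $X=\{\mathbf x_k\}_{k\in I}$ with a measure $\mu$ on $I$ is an $(s,\delta)$-packing if $\mu(I)\ge\delta$ and $\mu(J)\le\Pr[\exists k\in J:\mathbf r\cdot\mathbf x_k\ge s]$ for every $J\subseteq I$. Theorem. There is an absolute constant $K>0$, and for every $c>0$ there are $C>0$ and $n_0$ depending only on $c$, such that the following holds for all $n\ge n_0$. Let $G=(V,E)$ be an $n$-vertex graph with a strict vector 3-coloring $\{\mathbf v_i\}$, let $t>e$ (so that $\log\log t>0$) be $c$-inefficient for $G$, and assume that $\mathrm{KMS}'$ fails on $G$ with parameter $t$. Then there is a non-empty subgraph $G'=(V',E')$ of $G$ such that every $i\in V'$ satisfies: (1) $\mu_i(N_{G'}(i))\ \ge\ \frac18-\frac{K}{\log\log t}$; (2) for every $j\in N_{G'}(i)$, the family $W_{ij}=\left\{\mathbf v_{jk}: k\in N_{G'}(j),\ -\frac1{\log\log t}\le\mathbf v_{ji}\cdot\mathbf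 v_{jk}\le\frac c{1+c}\left(1+\frac C{\log t}\right)\right\}$, indexed by $k$, with the measure $\mu_j$, is a $\left(\sqrt3\,t,\ \frac1{2(\log\log t)^2}\right)$-packing. -/

import Mathlib

open MeasureTheory ProbabilityTheory

noncomputable section

/-- `d`-dimensional Euclidean space. -/
abbrev Vec (d : ℕ) : Type := EuclideanSpace ℝ (Fin d)

/-- The standard Gaussian tail `Φ̄(t) = 1 - Φ(t)`. -/
def gaussianTail (t : ℝ) : ℝ := 1 - cdf (gaussianReal 0 1) t

/-- A strict vector `κ`-coloring of `G`: unit vectors with `v i · v j = -1/(κ-1)` on every edge. -/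
structure IsStrictVectorColoring {V : Type*} {d : ℕ} (G : SimpleGraph V) (κ : ℝ) (v : V → Vec d) :
    Prop where
  norm_eq_one : ∀ i, ‖v i‖ = 1
  inner_eq : ∀ i j, G.Adj i j → inner ℝ (v i) (v j) = -(1 / (κ - 1))

/-- The normalized component `v_{ij}` of `v j` orthogonal to `v i`
(meaningful when that component is nonzero, as it is on the edges of a strict vector 3-coloring). -/
def orthDir {V : Type*} {d : ℕ} (v : V → Vec d) (i j : V) : Vec d :=
  ‖v j - inner ℝ (v i) (v j) • v i‖⁻¹ • (v j - inner ℝ (v i) (v j) • v i)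

/-- A finite family of unit vectors `x k`, `k ∈ I`, with a measure given by point weights `μ k`,
is an `(s, δ)`-packing: every subfamily has measure at most the probability that a standard
Gaussian vector has inner product at least `s` with one of its members, and the whole family has
measure at least `δ`. -/
structure IsPacking {ι : Type*} {d : ℕ} (I : Finset ι) (x : ι → Vec d) (μ : ι → ℝ) (s δ : ℝ) :
    Prop where
  norm_eq_one : ∀ k ∈ I, ‖x k‖ = 1
  nonneg : ∀ k ∈ I, 0 ≤ μ k
  sum_le : ∀ J ⊆ I, ∑ k ∈ J, μ k ≤ (stdGaussian (Vec d)).real {r | ∃ k ∈ J, s ≤ inner ℝ r (x k)}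
  le_sum : δ ≤ ∑ k ∈ I, μ k

/-- The set of vertices selected by the Gaussian vector `r` at threshold `t`. -/
def selected {V : Type*} {d : ℕ} (v : V → Vec d) (t : ℝ) (r : Vec d) : Set V :=
  {i | t ≤ inner ℝ r (v i)}

/-- `M` is an (inclusion-)maximal matching of the subgraph of `G` induced by `S`. -/
def IsMaximalMatchingIn {V : Type*} (G : SimpleGraph V) (S : Set V) (M : G.Subgraph) : Prop :=
  Maximal (fun N : G.Subgraph => N.IsMatching ∧ N.verts ⊆ S) M

/-- A run of the algorithm `KMS'` on `G`, `v` with threshold `t`: on the probability space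
`(Ω, P)`, `r` is the standard Gaussian vector sampled, and `M` is the maximal matching found in the
selected set. The rule that finds `M` is arbitrary (and may use further randomness). The algorithm
removes the vertices of `M` from the selected set and returns the remaining vertices. -/
structure IsKMSPrimeRun {V : Type*} {d : ℕ} (G : SimpleGraph V) (v : V → Vec d) (t : ℝ)
    {Ω : Type*} [MeasurableSpace Ω] (P : Measure Ω) (r : Ω → Vec d) (M : Ω → G.Subgraph) :
    Prop where
  measurable_r : Measurable r
  law_r : P.map r = stdGaussian (Vec d)
  measurable_M : ∀ i j, MeasurableSet {ω | (M ω).Adj i j}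
  maximal : ∀ ω, IsMaximalMatchingIn G (selected v t (r ω)) (M ω)

section Run

variable {V : Type*} {d : ℕ} {G : SimpleGraph V} {Ω : Type*} [MeasurableSpace Ω]

/-- `p_i`: the probability that `i` is removed, given that `i` is selected. -/
def removalProb (v : V → Vec d) (t : ℝ) (P : Measure Ω) (r : Ω → Vec d) (M : Ω → G.Subgraph)
    (i : V) : ℝ :=
  (cond P {ω | i ∈ selected v t (r ω)}).real {ω | i ∈ (M ω).verts}

/-- `μ_i(j)`: the probability that the edge `{i, j}` is in `M`, given that `i` is selected. -/
def edgeWeight (v : V → Vec d) (t : ℝ) (P : Measure Ω) (r : Ω → Vec d) (M : Ω → G.Subgraph)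
    (i j : V) : ℝ :=
  (cond P {ω | i ∈ selected v t (r ω)}).real {ω | (M ω).Adj i j}

/-- `KMS'` fails: at least half of the vertices, when selected, are removed with conditional
probability at least `1/2`. -/
def KMSPrimeFails [Fintype V] (v : V → Vec d) (t : ℝ) (P : Measure Ω) (r : Ω → Vec d)
    (M : Ω → G.Subgraph) : Prop :=
  (Fintype.card V : ℝ) / 2 ≤ ({i | 1 / 2 ≤ removalProb v t P r M i} : Set V).ncard

end Run

open scoped Classical in
/-- The parameter `t` is `c`-inefficient for `G`: `Φ̄(t) = Δ(G)^(-1/(3(1+c)))`. -/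
def IsInefficientParam {V : Type*} [Fintype V] (G : SimpleGraph V) (c t : ℝ) : Prop :=
  gaussianTail t = (G.maxDegree : ℝ) ^ (-(1 / (3 * (1 + c))))

open scoped Classical in
/-- The neighbors of `i` in the subgraph `H`. -/
def nbrs {V : Type*} [Fintype V] {G : SimpleGraph V} (H : G.Subgraph) (i : V) : Finset V :=
  Finset.univ.filter fun j => H.Adj i j

open scoped Classical in
/-- The index set of `W_{ij}`: the neighbors `k` of `j` in `H` with
`-1/log log t ≤ v_{ji} · v_{jk} ≤ c/(1+c) * (1 + C/log t)`. -/
def twoStep {V : Type*} [Fintype V] {d : ℕ} {G : SimpleGraph V} (H : G.Subgraph) (v : V → Vec d)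
    (c C t : ℝ) (i j : V) : Finset V :=
  (nbrs H j).filter fun k =>
    -(1 / Real.log (Real.log t)) ≤ inner ℝ (orthDir v j i) (orthDir v j k) ∧
      inner ℝ (orthDir v j i) (orthDir v j k) ≤ c / (1 + c) * (1 + C / Real.log t)

end

/-!
The proof takes a minimal subgraph for a weight balance; what makes the balance work is that a
vertex `j` can only ever reject neighbors `i` of total weight `O(1 / L)`, where `L = log log t`.

The weights `μ_i(j)` are symmetric, since every vertex is selected with the same probability, and
they satisfy the packing inequality: if both ends of an edge at `j` are selected, then the Gaussian
vector has inner product at least `√3 * t` with the direction of the edge, and this direction is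
orthogonal to `v j`, hence independent of the selection of `j`
(`IsKMSPrimeRun.sum_edgeWeight_le`). When the algorithm fails, the weighted degrees add up to at
least `n / 4`. Delete vertices whose weighted degree is below `1 / 8 - 4 / L`, and edges `i j` for
which `j` sees too little weight at middle correlation with `i`, that is, correlation between
`-1 / L` and `c / (1 + c) * (1 + C / log t)`. If no vertex rejects weight more than `3 / L`, then
the deletion cannot use up the graph (`exists_pruned_subgraph`), and what remains is the required
subgraph.

The bound on the rejected weight (`sum_rejected_le`) has two parts. A rejected `i` that has little
weight above the middle range has little weight at correlation at least `-1 / L` altogether. The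
rejected vectors of this kind are covered by the neighborhoods of pairwise separated ones, and unit
vectors with pairwise inner products below `-1 / L` number at most `L + 1`.

The other part, the vectors with much weight above the middle range, is where the degree bound
enters. Vectors that all have inner product above `σ`, with `σ ^ 2` slightly above `c / (1 + c)`,
with one unit vector have tiny weight: by the union bound over at most `Δ` vectors, it is unlikely
that a Gaussian vector reaches `√3 * t` on any of them (`stdGaussian_exists_clustered_le`,
`exp_mul_exp_clustered_le`). To lower the correlation from `σ` to about `σ ^ 2`, one builds a center
greedily (`exists_center`): add up members of the family, each close to many of the remaining
vectors and of correlation at most `σ` with the current sum `S`. After `m` steps `‖S‖` is about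
`σ * m`, while the vectors `y` that are close to all chosen members have inner product at least
`ρ * m` with `S`, so they have correlation about `ρ / σ > σ` with it. The loss of this construction
is `exp (O(log t ^ 2 * log L))`, far less than the gain `exp (Ω(t ^ 2 / log t ^ 2))`.

For `t` bounded in terms of `c`, a large `C` makes the middle range reach `1`. For `L ≤ 32` the
bound on the weighted degrees is vacuous, and an isolated vertex satisfies the claim.
-/

/-! ### Pruning a weighted graph -/

theorem mem_nbrs {V : Type*} [Fintype V] {G : SimpleGraph V} (H : G.Subgraph) (i j : V) :
    j ∈ nbrs H i ↔ H.Adj i j := by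
  simp [nbrs]

open scoped Classical in
theorem sum_nbrs {V : Type*} [Fintype V] {G : SimpleGraph V} (H : G.Subgraph) (i : V)
    (f : V → ℝ) : ∑ j ∈ nbrs H i, f j = ∑ j, if H.Adj i j then f j else 0 := by
  rw [nbrs, Finset.sum_filter]

theorem nbrs_mono {V : Type*} [Fintype V] {G : SimpleGraph V} {H H' : G.Subgraph} (h : H ≤ H')
    (i : V) : nbrs H i ⊆ nbrs H' i := by
  intro j hj
  rw [mem_nbrs] at hj ⊢
  exact h.2 hj

/-- The sum of the weighted degrees in `H`: every edge is counted from both of its ends. -/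
noncomputable def totalWeight {V : Type*} [Fintype V] {G : SimpleGraph V} (w : V → V → ℝ) (H : G.Subgraph) : ℝ :=
  ∑ i, ∑ j ∈ nbrs H i, w i j

theorem totalWeight_deleteVerts {V : Type*} [Fintype V] {G : SimpleGraph V} {w : V → V → ℝ}
    (hw : ∀ i j, w i j = w j i) (H : G.Subgraph) (i : V) :
    totalWeight w H = totalWeight w (H.deleteVerts {i}) + 2 * ∑ j ∈ nbrs H i, w i j := by
  classical
  have key : ∀ x y, (if H.Adj x y then w x y else 0) =
      (if (H.deleteVerts {i}).Adj x y then w x y else 0)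
        + (if x = i then (if H.Adj i y then w i y else 0) else 0)
        + (if y = i then (if H.Adj i x then w i x else 0) else 0) := by
    intro x y
    by_cases hxy : H.Adj x y
    · have hx := H.edge_vert hxy
      have hy := H.edge_vert hxy.symm
      have hne := hxy.ne
      by_cases h1 : x = i
      · subst h1
        simp [hxy, hne.symm]
      · by_cases h2 : y = i
        · subst h2
          simp [hxy, hxy.symm, h1, hw x y]
        · simp [hxy, h1, h2, hx, hy]
    · by_cases h1 : x = i
      · subst h1
        by_cases h2 : y = x
        · subst h2
          simp [hxy]
        · simp [hxy, h2]
      · by_cases h2 : y = i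
        · subst h2
          have : ¬ H.Adj y x := fun h => hxy h.symm
          simp [hxy, this, h1]
        · simp [hxy, h1, h2]
  unfold totalWeight
  simp_rw [sum_nbrs]
  rw [Finset.sum_congr rfl fun x _ => Finset.sum_congr rfl fun y _ => key x y]
  simp only [Finset.sum_add_distrib]
  have e1 : ∑ x, ∑ y, (if x = i then (if H.Adj i y then w i y else 0) else 0)
      = ∑ y, if H.Adj i y then w i y else 0 := by
    rw [Finset.sum_comm]; simp
  have e2 : ∑ x, ∑ y, (if y = i then (if H.Adj i x then w i x else 0) else 0)
      = ∑ y, if H.Adj i y then w i y else 0 := by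
    simp
  rw [e1, e2, add_assoc, ← two_mul]
  congr!

theorem totalWeight_deleteEdge {V : Type*} [Fintype V] {G : SimpleGraph V} {w : V → V → ℝ}
    (hw : ∀ i j, w i j = w j i) (H : G.Subgraph) {i j : V} (h : H.Adj i j) :
    totalWeight w H = totalWeight w (H.deleteEdges {s(i, j)}) + 2 * w i j := by
  classical
  have hne := h.ne
  have key : ∀ x y, (if H.Adj x y then w x y else 0) =
      (if (H.deleteEdges {s(i, j)}).Adj x y then w x y else 0)
        + (if x = i then (if y = j then w i j else 0) else 0)
        + (if x = j then (if y = i then w i j else 0) else 0) := by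
    intro x y
    by_cases h1 : x = i ∧ y = j
    · obtain ⟨rfl, rfl⟩ := h1
      simp [h, hne]
    · by_cases h2 : x = j ∧ y = i
      · obtain ⟨rfl, rfl⟩ := h2
        simp [h.symm, hne.symm, hw x y]
      · have e1 : (if x = i then (if y = j then w i j else 0) else 0) = 0 := by
          rw [← ite_and, if_neg h1]
        have e2 : (if x = j then (if y = i then w i j else 0) else 0) = 0 := by
          rw [← ite_and, if_neg h2]
        have e3 : s(x, y) ≠ s(i, j) := by
          rw [Ne, Sym2.eq_iff]; tauto
        simp [e1, e2, e3]
  unfold totalWeight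
  simp_rw [sum_nbrs, key, Finset.sum_add_distrib]
  simp only [Finset.sum_ite_eq', Finset.mem_univ, if_true, Finset.sum_ite_irrel,
    Finset.sum_const_zero]
  ring

/-- Pruning. Every vertex `j` keeps a record `D` of the neighbors it has rejected, and `R j D N`
says that `D` is a legitimate record when `N` is the current neighborhood. If the weight a vertex
can ever reject is at most `B` and the average weighted degree exceeds `2 * (θ + B)`, then deleting
vertices of weighted degree below `θ` and edges `i j` with `i` bad for `j` cannot use up the
graph. A minimal subgraph that satisfies the weight balance is the result of the deletion. -/
theorem exists_pruned_subgraph {V : Type*} [Fintype V] [DecidableEq V] {G : SimpleGraph V}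
    {w : V → V → ℝ} (hw : ∀ i j, w i j = w j i) {θ B : ℝ}
    (Bad : V → Finset V → V → Prop) (R : V → Finset V → Finset V → Prop)
    (hempty : ∀ j N, R j ∅ N)
    (hmono : ∀ j D N N', N' ⊆ N → R j D N → R j D N')
    (hstep : ∀ j D N i, N ⊆ nbrs (⊤ : G.Subgraph) j → R j D N → i ∈ N → Bad j N i →
      i ∉ D ∧ R j (insert i D) (N.erase i))
    (hbound : ∀ j D N, R j D N → ∑ i ∈ D, w j i ≤ B)
    (htot : 2 * (θ + B) * Fintype.card V < totalWeight w (⊤ : G.Subgraph)) :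
    ∃ H : G.Subgraph, H.verts.Nonempty ∧ ∀ i ∈ H.verts,
      θ ≤ ∑ j ∈ nbrs H i, w i j ∧ ∀ j, H.Adj i j → ¬ Bad j (nbrs H j) i := by
  classical
  let Q : G.Subgraph → Prop := fun H => ∃ D : V → Finset V, (∀ j, R j (D j) (nbrs H j)) ∧
    2 * θ * H.verts.ncard + 2 * B * Fintype.card V
      < totalWeight w H + 2 * ∑ j, ∑ i ∈ D j, w j i
  have hQ : Q ⊤ := by
    refine ⟨fun _ => ∅, fun j => hempty j _, ?_⟩
    have : (⊤ : G.Subgraph).verts.ncard = Fintype.card V := by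
      simp [Set.ncard_univ]
    rw [this]
    simp only [Finset.sum_empty, Finset.sum_const_zero]
    linarith
  obtain ⟨H, hH⟩ := exists_minimal_of_wellFoundedLT Q ⟨⊤, hQ⟩
  obtain ⟨D, hR, hD⟩ := hH.1
  have hmin : ∀ H' : G.Subgraph, H' ≤ H → Q H' → H ≤ H' := fun H' h h' => hH.2 h' h
  refine ⟨H, ?_, fun i hi => ⟨?_, fun j hij hbad => ?_⟩⟩
  · by_contra hne
    rw [Set.not_nonempty_iff_eq_empty] at hne
    have h1 : totalWeight w H = 0 := by
      unfold totalWeight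
      refine Finset.sum_eq_zero fun i _ => ?_
      rw [sum_nbrs]
      refine Finset.sum_eq_zero fun j _ => ?_
      rw [if_neg]
      intro h
      have := H.edge_vert h
      rw [hne] at this
      exact this
    have h2 : ∑ j, ∑ i ∈ D j, w j i ≤ ∑ _j : V, B :=
      Finset.sum_le_sum fun j _ => hbound j _ _ (hR j)
    rw [Finset.sum_const, nsmul_eq_mul, Finset.card_univ] at h2
    rw [h1, hne, Set.ncard_empty] at hD
    push_cast at hD
    linarith
  · by_contra! hlt
    have hle : H.deleteVerts {i} ≤ H := SimpleGraph.Subgraph.deleteVerts_le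
    have hq : Q (H.deleteVerts {i}) := by
      refine ⟨D, fun j => hmono j _ _ _ (nbrs_mono hle j) (hR j), ?_⟩
      have e := totalWeight_deleteVerts hw H i
      have hc : ((H.deleteVerts {i}).verts.ncard : ℝ) = H.verts.ncard - 1 := by
        have := Set.ncard_sdiff_singleton_add_one hi
        rw [SimpleGraph.Subgraph.deleteVerts_verts, ← this]
        push_cast
        ring
      rw [hc]
      linarith
    have := (hmin _ hle hq).1 hi
    simp at this
  · have hle : H.deleteEdges {s(j, i)} ≤ H := SimpleGraph.Subgraph.deleteEdges_le _
    have hmem : i ∈ nbrs H j := (mem_nbrs H j i).2 hij.symm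
    obtain ⟨hiD, hRi⟩ := hstep j (D j) _ i (nbrs_mono le_top j) (hR j) hmem hbad
    have hq : Q (H.deleteEdges {s(j, i)}) := by
      refine ⟨Function.update D j (insert i (D j)), fun x => ?_, ?_⟩
      · by_cases hx : x = j
        · subst hx
          rw [Function.update_self]
          refine hmono _ _ _ _ ?_ hRi
          intro y hy
          rw [mem_nbrs, SimpleGraph.Subgraph.deleteEdges_adj] at hy
          rw [Finset.mem_erase, mem_nbrs]
          refine ⟨?_, hy.1⟩
          rintro rfl
          exact hy.2 rfl
        · rw [Function.update_of_ne hx]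
          exact hmono x _ _ _ (nbrs_mono hle x) (hR x)
      · have e := totalWeight_deleteEdge hw H hij.symm
        have e2 : ∑ x, ∑ y ∈ Function.update D j (insert i (D j)) x, w x y
            = ∑ x, ∑ y ∈ D x, w x y + w j i := by
          rw [← Finset.add_sum_erase _ _ (Finset.mem_univ j),
            ← Finset.add_sum_erase (Finset.univ) (fun x => ∑ y ∈ D x, w x y) (Finset.mem_univ j),
            Function.update_self, Finset.sum_insert hiD]
          have : ∑ x ∈ Finset.univ.erase j, ∑ y ∈ Function.update D j (insert i (D j)) x, w x y
              = ∑ x ∈ Finset.univ.erase j, ∑ y ∈ D x, w x y := by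
            refine Finset.sum_congr rfl fun x hx => ?_
            rw [Function.update_of_ne (Finset.ne_of_mem_erase hx)]
          rw [this]
          ring
        rw [e2, SimpleGraph.Subgraph.deleteEdges_verts]
        linarith
    have := (hmin _ hle hq).2 hij.symm
    simp at this

/-! ### Weighted families of unit vectors -/

section Geometry

variable {ι E : Type*} [NormedAddCommGroup E] [InnerProductSpace ℝ E]

/-- A family in which every nonempty subfamily has a member `i` whose near members carry weight at
most `δ` is covered by the neighborhoods of pairwise non-near members. -/
theorem exists_separated_of_sparse {w : ι → ℝ} {near : ι → ι → Prop} {δ : ℝ} (D : Finset ι)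
    (hrefl : ∀ i, near i i)
    (hD : ∀ D' ⊆ D, D'.Nonempty → ∃ i ∈ D', ∀ F ⊆ D', (∀ k ∈ F, near i k) → ∑ k ∈ F, w k ≤ δ) :
    ∃ I ⊆ D, ((I : Set ι).Pairwise fun i k => ¬ near i k ∨ ¬ near k i) ∧
      ∑ i ∈ D, w i ≤ I.card * δ := by
  classical
  induction D using Finset.strongInduction with
  | H D ih =>
    rcases D.eq_empty_or_nonempty with rfl | hne
    · exact ⟨∅, le_rfl, by simp, by simp⟩
    obtain ⟨i, hi, hsp⟩ := hD D le_rfl hne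
    have hss : D.filter (fun k => ¬ near i k) ⊂ D := by
      refine Finset.filter_ssubset.2 ⟨i, hi, ?_⟩
      simpa using hrefl i
    obtain ⟨I, hI, hsep, hle⟩ := ih _ hss fun D' h' => hD D' (h'.trans hss.subset)
    have hiI : i ∉ I := fun h => (Finset.mem_filter.1 (hI h)).2 (hrefl i)
    refine ⟨insert i I, ?_, ?_, ?_⟩
    · intro k hk
      rcases Finset.mem_insert.1 hk with rfl | hk
      · exact hi
      · exact hss.subset (hI hk)
    · rw [Finset.coe_insert, Set.pairwise_insert]
      refine ⟨hsep, fun k hk _ => ?_⟩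
      have := (Finset.mem_filter.1 (hI hk)).2
      exact ⟨Or.inl this, Or.inr this⟩
    · rw [Finset.card_insert_of_notMem hiI, ← Finset.sum_filter_add_sum_filter_not D (near i)]
      have := hsp (D.filter (near i)) (Finset.filter_subset _ _)
        (fun k hk => (Finset.mem_filter.1 hk).2)
      push_cast
      linarith

/-- Unit vectors with pairwise inner products below `-ε` are few, since the square of their sum is
nonnegative. -/
theorem card_mul_le_of_pairwise_inner_lt {x : ι → E} {ε : ℝ} (hε : 0 ≤ ε)
    (I : Finset ι) (hx : ∀ i ∈ I, ‖x i‖ = 1)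
    (hI : (I : Set ι).Pairwise fun i k => inner ℝ (x i) (x k) < -ε) :
    I.card * ε ≤ 1 + ε := by
  classical
  rcases I.eq_empty_or_nonempty with rfl | hne
  · simp only [Finset.card_empty, Nat.cast_zero, zero_mul]; linarith
  have h0 : 0 ≤ inner ℝ (∑ i ∈ I, x i) (∑ k ∈ I, x k) := real_inner_self_nonneg
  rw [sum_inner] at h0
  have h1 : ∀ i ∈ I, inner ℝ (x i) (∑ k ∈ I, x k) ≤ 1 + (I.card - 1) * (-ε) := by
    intro i hi
    rw [inner_sum, ← Finset.add_sum_erase _ _ hi, real_inner_self_eq_norm_sq, hx i hi]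
    have : ∑ k ∈ I.erase i, inner ℝ (x i) (x k) ≤ ∑ k ∈ I.erase i, (-ε) :=
      Finset.sum_le_sum fun k hk =>
        (hI hi (Finset.mem_of_mem_erase hk) (Finset.ne_of_mem_erase hk).symm).le
    rw [Finset.sum_const, nsmul_eq_mul, Finset.card_erase_of_mem hi,
      Nat.cast_sub (Finset.card_pos.2 hne)] at this
    push_cast at this
    linarith
  have h2 := h0.trans (Finset.sum_le_sum h1)
  rw [Finset.sum_const, nsmul_eq_mul] at h2
  have hc : (0 : ℝ) < I.card := by exact_mod_cast Finset.card_pos.2 hne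
  have := nonneg_of_mul_nonneg_right h2 hc
  linarith

/-- Averaging: if every member of `D` is close to members of `T` of total weight at least `β`,
then some member of `T` is close to a `β` fraction of `D`. -/
theorem exists_popular {w : ι → ℝ} (hw : ∀ i, 0 ≤ w i) {T D : Finset ι} {close : ι → ι → Prop}
    [DecidableRel close] {β : ℝ} (hβ : 0 < β) (hT : ∑ k ∈ T, w k ≤ 1)
    (hD : 0 < ∑ y ∈ D, w y) (hdeg : ∀ y ∈ D, β ≤ ∑ k ∈ T with close y k, w k) :
    ∃ k ∈ T, β * ∑ y ∈ D, w y ≤ ∑ y ∈ D with close y k, w y := by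
  by_contra! hlt
  set c := β * ∑ y ∈ D, w y with hc
  have hcpos : 0 < c := mul_pos hβ hD
  have h1 : c ≤ ∑ k ∈ T, w k * ∑ y ∈ D with close y k, w y := by
    calc c = ∑ y ∈ D, w y * β := by rw [hc, Finset.mul_sum]; simp_rw [mul_comm]
      _ ≤ ∑ y ∈ D, w y * ∑ k ∈ T with close y k, w k :=
        Finset.sum_le_sum fun y hy => mul_le_mul_of_nonneg_left (hdeg y hy) (hw y)
      _ = ∑ k ∈ T, w k * ∑ y ∈ D with close y k, w y := by
        simp_rw [Finset.sum_filter, Finset.mul_sum]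
        rw [Finset.sum_comm]
        refine Finset.sum_congr rfl fun k _ => Finset.sum_congr rfl fun y _ => ?_
        split_ifs <;> ring
  have h2 : ∃ k ∈ T, 0 < w k := by
    by_contra! h
    have : ∑ k ∈ T, w k * ∑ y ∈ D with close y k, w y = 0 :=
      Finset.sum_eq_zero fun k hk => by rw [le_antisymm (h k hk) (hw k), zero_mul]
    linarith
  obtain ⟨k₀, hk₀, hpos⟩ := h2
  have h3 : ∑ k ∈ T, w k * ∑ y ∈ D with close y k, w y < ∑ k ∈ T, w k * c :=
    Finset.sum_lt_sum (fun k hk => mul_le_mul_of_nonneg_left (hlt k hk).le (hw k))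
      ⟨k₀, hk₀, mul_lt_mul_of_pos_left (hlt k₀ hk₀) hpos⟩
  rw [← Finset.sum_mul] at h3
  have h4 : (∑ k ∈ T, w k) * c ≤ 1 * c := mul_le_mul_of_nonneg_right hT hcpos.le
  linarith

/-- Greedy construction of a center. Members of `N` are added to `S` one at a time; each is close
to many of the vectors that are kept, and none is strongly correlated with the current `S`, so `S`
stays short while its inner product with every vector of `D` grows linearly. -/
theorem exists_center {w : ι → ℝ} (hw : ∀ i, 0 ≤ w i) {N A : Finset ι} {x : ι → E}
    (hx : ∀ i ∈ N, ‖x i‖ = 1) (hN : ∑ k ∈ N, w k ≤ 1) {σ τ ρ α ℓ : ℝ} (hσ : 0 < σ) (hℓ : 0 < ℓ)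
    (hτα : τ < α)
    (hτ : ∀ S : E, ∑ k ∈ N with σ * ‖S‖ < inner ℝ (x k) S, w k ≤ τ)
    (hA : ∀ y ∈ A, α ≤ ∑ k ∈ N with ρ ≤ inner ℝ (x y) (x k), w k)
    (hApos : 0 < ∑ y ∈ A, w y) (m : ℕ) :
    ∃ S : E, ∃ D ⊆ A, (∀ y ∈ D, m * ρ ≤ inner ℝ (x y) S) ∧
      ‖S‖ ≤ σ * (1 + ℓ) * m + 1 / (2 * σ * ℓ) ∧
      (α - τ) ^ m * ∑ y ∈ A, w y ≤ ∑ y ∈ D, w y := by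
  induction m with
  | zero =>
    refine ⟨0, A, le_rfl, by simp, ?_, by simp⟩
    simp only [norm_zero, Nat.cast_zero, mul_zero, zero_add]
    positivity
  | succ m ih =>
    obtain ⟨S, D, hDA, hin, hnorm, hwt⟩ := ih
    have hβ : 0 < α - τ := sub_pos.2 hτα
    have hDpos : 0 < ∑ y ∈ D, w y := lt_of_lt_of_le (by positivity) hwt
    obtain ⟨k, hk, hpop⟩ := exists_popular (close := fun y k => ρ ≤ inner ℝ (x y) (x k))
      (T := N.filter fun k => ¬ σ * ‖S‖ < inner ℝ (x k) S) (D := D) hw hβ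
      ((Finset.sum_le_sum_of_subset_of_nonneg (Finset.filter_subset _ _)
        fun k _ _ => hw k).trans hN) hDpos (by
        intro y hy
        have h1 := hA y (hDA hy)
        rw [← Finset.sum_filter_add_sum_filter_not _ fun k => σ * ‖S‖ < inner ℝ (x k) S] at h1
        have h2 : ∑ k ∈ (N.filter fun k => ρ ≤ inner ℝ (x y) (x k)) with
            σ * ‖S‖ < inner ℝ (x k) S, w k ≤ τ := by
          refine le_trans (Finset.sum_le_sum_of_subset_of_nonneg ?_ fun k _ _ => hw k) (hτ S)
          exact Finset.filter_subset_filter _ (Finset.filter_subset _ _)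
        rw [Finset.filter_filter]
        rw [Finset.filter_filter] at h1
        rw [Finset.filter_filter] at h2
        rw [Finset.filter_filter] at h1
        simp_rw [and_comm (a := ¬ _)]
        linarith)
    rw [Finset.mem_filter, not_lt] at hk
    refine ⟨S + x k, D.filter fun y => ρ ≤ inner ℝ (x y) (x k),
      (Finset.filter_subset _ _).trans hDA, ?_, ?_, ?_⟩
    · intro y hy
      rw [Finset.mem_filter] at hy
      rw [inner_add_right]
      push_cast
      linarith [hin y hy.1]
    · set b := 1 / (2 * σ * ℓ) with hb
      have hbpos : 0 < b := by positivity
      have hbσ : 2 * σ * ℓ * b = 1 := by rw [hb]; field_simp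
      refine le_of_sq_le_sq ?_ (by positivity)
      have e := norm_add_sq_real S (x k)
      rw [real_inner_comm, hx k hk.1] at e
      have hn := norm_nonneg S
      set a := σ * (1 + ℓ) * m + b with ha
      have hapos : 0 < a := by positivity
      have hab : b ≤ a := by
        rw [ha]
        have : 0 ≤ σ * (1 + ℓ) * m := by positivity
        linarith
      have h1 : ‖S‖ ^ 2 ≤ a ^ 2 := pow_le_pow_left₀ hn hnorm 2
      have h2 : σ * ‖S‖ ≤ σ * a := mul_le_mul_of_nonneg_left hnorm hσ.le
      have h3 : 2 * σ * ℓ * b ≤ 2 * σ * ℓ * a := mul_le_mul_of_nonneg_left hab (by positivity)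
      have h4 : 0 ≤ (σ * (1 + ℓ)) ^ 2 := sq_nonneg _
      have e2 : σ * (1 + ℓ) * ((m + 1 : ℕ) : ℝ) + b = a + σ * (1 + ℓ) := by
        rw [ha]; push_cast; ring
      rw [e2, e]
      nlinarith [hk.2]
    · rw [pow_succ', mul_assoc]
      exact (mul_le_mul_of_nonneg_left hwt hβ.le).trans hpop

/-- If no center attracts weight more than `τ` at correlation `σ`, then few members have many
other members at correlation `ρ`, already for `ρ` slightly above `σ ^ 2`. -/
theorem weight_clustered_le {w : ι → ℝ} (hw : ∀ i, 0 ≤ w i) {N A : Finset ι} {x : ι → E}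
    (hAN : A ⊆ N)
    (hx : ∀ i ∈ N, ‖x i‖ = 1) (hN : ∑ k ∈ N, w k ≤ 1) {σ τ ρ α ℓ : ℝ} (hσ : 0 < σ) (hℓ : 0 < ℓ)
    (hτα : τ < α)
    (hτ : ∀ S : E, ∑ k ∈ N with σ * ‖S‖ < inner ℝ (x k) S, w k ≤ τ)
    (hA : ∀ y ∈ A, α ≤ ∑ k ∈ N with ρ ≤ inner ℝ (x y) (x k), w k) (m : ℕ)
    (hm : σ ^ 2 * (1 + ℓ) * m + 1 / (2 * ℓ) < m * ρ) :
    (α - τ) ^ m * ∑ y ∈ A, w y ≤ τ := by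
  have hτ0 : 0 ≤ τ := le_trans (Finset.sum_nonneg fun k _ => hw k) (hτ 0)
  rcases (Finset.sum_nonneg fun y (_ : y ∈ A) => hw y).eq_or_lt with h0 | hpos
  · rw [← h0, mul_zero]; exact hτ0
  obtain ⟨S, D, hDA, hin, hnorm, hwt⟩ := exists_center hw hx hN hσ hℓ hτα hτ hA hpos m
  refine hwt.trans (le_trans ?_ (hτ S))
  refine Finset.sum_le_sum_of_subset_of_nonneg (fun y hy => ?_) fun k _ _ => hw k
  refine Finset.mem_filter.2 ⟨hAN (hDA hy), lt_of_lt_of_le ?_ (hin y hy)⟩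
  refine lt_of_le_of_lt ?_ hm
  refine (mul_le_mul_of_nonneg_left hnorm hσ.le).trans (le_of_eq ?_)
  field_simp

end Geometry

/-! ### Gaussian estimates -/

section Gaussian

variable {d : ℕ}

theorem map_inner_stdGaussian (u : Vec d) :
    (stdGaussian (Vec d)).map (fun r => inner ℝ r u)
      = gaussianReal 0 (Real.toNNReal (‖u‖ ^ 2)) := by
  have h : HasGaussianLaw (fun r : Vec d => innerSL ℝ u r) (stdGaussian (Vec d)) :=
    (IsGaussian.hasGaussianLaw_id (μ := stdGaussian (Vec d))).map_fun (innerSL ℝ u)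
  have e : (fun r : Vec d => inner ℝ r u) = fun r => innerSL ℝ u r := by
    ext r; simp [real_inner_comm]
  rw [e, h.map_eq_gaussianReal]
  have h1 : (stdGaussian (Vec d))[fun r => innerSL ℝ u r] = 0 :=
    integral_strongDual_stdGaussian (innerSL ℝ u)
  have h2 : Var[fun r => innerSL ℝ u r; stdGaussian (Vec d)] = ‖u‖ ^ 2 := by
    rw [← innerSL_apply_norm (𝕜 := ℝ) u]
    exact variance_dual_stdGaussian (innerSL ℝ u)
  rw [h1, h2]

theorem measurable_inner_right (u : Vec d) : Measurable fun r : Vec d => (inner ℝ r u : ℝ) := by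
  fun_prop

theorem stdGaussian_inner_ge_le (u : Vec d) {s b : ℝ} (hs : 0 ≤ s) (hb : 0 < b)
    (hu : ‖u‖ ^ 2 ≤ b) :
    (stdGaussian (Vec d)).real {r | s ≤ inner ℝ r u} ≤ Real.exp (-(s ^ 2 / (2 * b))) := by
  have hlaw := map_inner_stdGaussian u
  have hint : Integrable (fun r : Vec d => Real.exp (s / b * inner ℝ r u))
      (stdGaussian (Vec d)) := by
    have := integrable_exp_mul_gaussianReal (μ := 0) (v := Real.toNNReal (‖u‖ ^ 2)) (s / b)
    rw [← hlaw, integrable_map_measure (by fun_prop) (by fun_prop)] at this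
    exact this
  refine (measure_ge_le_exp_mul_mgf s (div_nonneg hs hb.le) hint).trans ?_
  rw [mgf_gaussianReal hlaw, ← Real.exp_add]
  refine Real.exp_le_exp.2 ?_
  rw [Real.coe_toNNReal _ (sq_nonneg _)]
  have : ‖u‖ ^ 2 * (s / b) ^ 2 / 2 ≤ b * (s / b) ^ 2 / 2 := by gcongr
  refine le_trans (by linarith) (le_of_eq (?_ : -(s / b) * s + b * (s / b) ^ 2 / 2 = _))
  field_simp
  ring

theorem gaussianTail_eq_real (t : ℝ) : gaussianTail t = (gaussianReal 0 1).real (Set.Ioi t) := by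
  rw [gaussianTail, cdf_eq_real, ← Set.compl_Iic, probReal_compl_eq_one_sub measurableSet_Iic]

theorem exp_le_gaussianTail {t : ℝ} (ht : 2 ≤ t) :
    Real.exp (-(t ^ 2 / 2 + 2 * t)) ≤ gaussianTail t := by
  rw [gaussianTail_eq_real]
  have h1 : (gaussianReal 0 1).real (Set.Ioc t (t + 1)) ≤ (gaussianReal 0 1).real (Set.Ioi t) :=
    measureReal_mono Set.Ioc_subset_Ioi_self
  refine le_trans ?_ h1
  rw [measureReal_def, gaussianReal_apply_eq_integral 0 one_ne_zero,
    ENNReal.toReal_ofReal (integral_nonneg fun x => gaussianPDFReal_nonneg _ _ _)]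
  have h2 : ∀ x ∈ Set.Ioc t (t + 1), Real.exp (-(t ^ 2 / 2 + 2 * t)) ≤ gaussianPDFReal 0 1 x := by
    intro x hx
    rw [gaussianPDFReal]
    have h3 : Real.exp (-1) ≤ (Real.sqrt (2 * Real.pi * (1 : NNReal)))⁻¹ := by
      rw [Real.exp_neg]
      refine inv_anti₀ (Real.sqrt_pos.2 (by positivity)) ?_
      rw [Real.sqrt_le_left (Real.exp_pos _).le]
      have := Real.pi_lt_d2
      have := Real.exp_one_gt_d9
      push_cast
      nlinarith
    have h4 : Real.exp (-(t ^ 2 / 2 + 2 * t) + 1)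
        ≤ Real.exp (-(x - 0) ^ 2 / (2 * (1 : NNReal))) := by
      refine Real.exp_le_exp.2 ?_
      have h5 := hx.1
      have h6 := hx.2
      push_cast
      nlinarith
    calc Real.exp (-(t ^ 2 / 2 + 2 * t)) = Real.exp (-1) * Real.exp (-(t ^ 2 / 2 + 2 * t) + 1) := by
          rw [← Real.exp_add]; congr 1; ring
      _ ≤ _ := mul_le_mul h3 h4 (Real.exp_pos _).le (by positivity)
  have h7 := setIntegral_mono_on (μ := volume) (s := Set.Ioc t (t + 1))
    (f := fun _ => Real.exp (-(t ^ 2 / 2 + 2 * t))) (g := gaussianPDFReal 0 1)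
    (integrableOn_const (by simp)) (integrable_gaussianPDFReal 0 1).integrableOn
    measurableSet_Ioc h2
  simpa using h7

theorem gaussianTail_pos {t : ℝ} (ht : 2 ≤ t) : 0 < gaussianTail t :=
  (Real.exp_pos _).trans_le (exp_le_gaussianTail ht)

/-- Vectors that share a component along `S` are unlikely to have a large inner product with a
Gaussian vector: up to the event that the common component is at least `h`, each must reach
`s - h` with its remaining part, which has variance at most `1 - σ ^ 2`. -/
theorem stdGaussian_exists_clustered_le {ι : Type*} (J : Finset ι) (x : ι → Vec d) (S : Vec d)
    {σ s h : ℝ} (hσ : 0 ≤ σ) (hσ1 : σ ^ 2 < 1) (h0 : 0 ≤ h) (hs : h ≤ s)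
    (hx : ∀ k ∈ J, ‖x k‖ = 1) (hJ : ∀ k ∈ J, σ * ‖S‖ < inner ℝ (x k) S) :
    (stdGaussian (Vec d)).real {r | ∃ k ∈ J, s ≤ inner ℝ r (x k)}
      ≤ Real.exp (-(h ^ 2 / 2)) + J.card * Real.exp (-((s - h) ^ 2 / (2 * (1 - σ ^ 2)))) := by
  rcases J.eq_empty_or_nonempty with rfl | ⟨k₀, hk₀⟩
  · simp only [Finset.notMem_empty, false_and, exists_false, Set.ofPred_false, measureReal_empty,
      Finset.card_empty, Nat.cast_zero, zero_mul, add_zero]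
    positivity
  have hS : 0 < ‖S‖ := by
    rw [norm_pos_iff]
    rintro rfl
    simpa using hJ k₀ hk₀
  set u : Vec d := ‖S‖⁻¹ • S with hu
  have hu1 : ‖u‖ = 1 := by
    rw [hu, norm_smul, norm_inv, norm_norm, inv_mul_cancel₀ hS.ne']
  have hxu : ∀ k ∈ J, σ ≤ inner ℝ (x k) u := by
    intro k hk
    rw [hu, inner_smul_right, ← div_eq_inv_mul, le_div_iff₀ hS]
    exact (hJ k hk).le
  have hsub : {r : Vec d | ∃ k ∈ J, s ≤ inner ℝ r (x k)} ⊆ {r | h ≤ inner ℝ r u} ∪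
      ⋃ k ∈ J, {r | s - h ≤ inner ℝ r (x k - (inner ℝ (x k) u : ℝ) • u)} := by
    rintro r ⟨k, hk, hr⟩
    by_cases hru : h ≤ inner ℝ r u
    · exact Or.inl hru
    · refine Or.inr (Set.mem_iUnion₂.2 ⟨k, hk, ?_⟩)
      rw [Set.mem_ofPred_eq, inner_sub_right, inner_smul_right]
      have h1 : (inner ℝ (x k) u : ℝ) ≤ 1 := by
        have := real_inner_le_norm (x k) u
        rwa [hx k hk, hu1, one_mul] at this
      have h2 := hσ.trans (hxu k hk)
      push Not at hru
      nlinarith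
  refine (measureReal_mono hsub).trans ((measureReal_union_le _ _).trans (add_le_add ?_ ?_))
  · have := stdGaussian_inner_ge_le u h0 one_pos (by rw [hu1]; norm_num)
    simpa using this
  · refine (measureReal_biUnion_finset_le _ _).trans ?_
    rw [← nsmul_eq_mul, ← Finset.sum_const]
    refine Finset.sum_le_sum fun k hk => ?_
    refine stdGaussian_inner_ge_le _ (sub_nonneg.2 hs) (sub_pos.2 hσ1) ?_
    rw [norm_sub_sq_real, norm_smul, inner_smul_right, hu1, hx k hk, mul_one, Real.norm_eq_abs,
      sq_abs]
    have := pow_le_pow_left₀ hσ (hxu k hk) 2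
    nlinarith

theorem indepFun_inner_sub_proj {u : Vec d} (hu : ‖u‖ = 1) :
    IndepFun (fun r : Vec d => (inner ℝ r u : ℝ)) (fun r : Vec d => r - (inner ℝ r u : ℝ) • u)
      (stdGaussian (Vec d)) := by
  let L : Vec d →L[ℝ] ℝ × Vec d := (innerSL ℝ u).prod
    (ContinuousLinearMap.id ℝ (Vec d) - (innerSL ℝ u).smulRight u)
  have hL : HasGaussianLaw (fun r : Vec d => ((inner ℝ r u : ℝ), r - (inner ℝ r u : ℝ) • u))
      (stdGaussian (Vec d)) := by
    have := (IsGaussian.hasGaussianLaw_id (μ := stdGaussian (Vec d))).map_fun L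
    simpa [L, real_inner_comm] using this
  refine hL.indepFun_of_covariance_inner fun a y => ?_
  have e := covarianceBilin_apply_eq_cov (μ := stdGaussian (Vec d)) IsGaussian.memLp_two_id
    (a • u) (y - (inner ℝ y u : ℝ) • u)
  rw [covarianceBilin_stdGaussian] at e
  have e1 : (innerSL ℝ (a • u)) (y - (inner ℝ y u : ℝ) • u) = (0 : ℝ) := by
    rw [innerSL_apply_apply, inner_sub_right, inner_smul_left, inner_smul_left, inner_smul_right,
      real_inner_self_eq_norm_sq, hu, real_inner_comm]
    simp
  rw [e1] at e
  rw [e]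
  congr 1
  · ext r
    simp [inner_smul_left, real_inner_comm, mul_comm]
  · ext r
    simp only [inner_sub_left, inner_sub_right, inner_smul_left, inner_smul_right,
      real_inner_comm u r]
    simp [mul_comm]

end Gaussian

/-! ### Size of the parameters -/

/-- With `h = c * ℓ * t / 8` and `σ ^ 2 = c / (1 + c) * (1 + ℓ)`, the gain `1 / (1 - σ ^ 2)` in the
exponent outweighs a family of size `exp (3 * (1 + c) * (t ^ 2 / 2 + 2 * t))`. -/
theorem exp_mul_exp_clustered_le {c ℓ t q : ℝ} (hc : 0 < c) (hℓ : 0 < ℓ) (ht : 0 < t)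
    (hq : q = c / (1 + c) * (1 + ℓ)) (hq1 : q < 1) (hbig : 12 ≤ c * ℓ * t) :
    Real.exp (3 * (1 + c) * (t ^ 2 / 2 + 2 * t))
        * Real.exp (-((Real.sqrt 3 * t - c * ℓ * t / 8) ^ 2 / (2 * (1 - q))))
      ≤ Real.exp (-((c * ℓ * t / 8) ^ 2 / 2)) := by
  rw [← Real.exp_add]
  refine Real.exp_le_exp.2 ?_
  have hc1 : 0 < 1 + c := by linarith
  have e1 : 1 - q = (1 - c * ℓ) / (1 + c) := by rw [hq]; field_simp; ring
  have hp : 0 < 1 - c * ℓ := by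
    have : 0 < (1 - c * ℓ) / (1 + c) := by rw [← e1]; linarith
    exact (div_pos_iff_of_pos_right hc1).1 this
  set p := c * ℓ with hpdef
  have hp0 : 0 < p := mul_pos hc hℓ
  have e2 : (Real.sqrt 3 * t - p * t / 8) ^ 2 / (2 * (1 - q))
      = (1 + c) / 2 * t ^ 2 * ((Real.sqrt 3 - p / 8) ^ 2 / (1 - p)) := by
    rw [e1]
    field_simp
  have hs3 : Real.sqrt 3 ^ 2 = 3 := Real.sq_sqrt (by norm_num)
  have hs2 : Real.sqrt 3 ≤ 2 := by
    rw [Real.sqrt_le_left (by norm_num)]; norm_num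
  have h1 : 3 + 2 * p ≤ (Real.sqrt 3 - p / 8) ^ 2 / (1 - p) := by
    rw [le_div_iff₀ hp]
    nlinarith
  have h2 : (1 + c) / 2 * t ^ 2 * (3 + 2 * p)
      ≤ (1 + c) / 2 * t ^ 2 * ((Real.sqrt 3 - p / 8) ^ 2 / (1 - p)) :=
    mul_le_mul_of_nonneg_left h1 (by positivity)
  rw [e2]
  have h3 : 12 * t ≤ p * t * t := mul_le_mul_of_nonneg_right hbig ht.le
  have h4 : (1 + c) * (12 * t) ≤ (1 + c) * (p * t * t) := mul_le_mul_of_nonneg_left h3 hc1.le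
  have h5 : p * t ^ 2 ≤ (1 + c) * (p * t ^ 2) := by
    have : 0 < c * (p * t ^ 2) := by positivity
    linarith
  have h6 : p ^ 2 * t ^ 2 ≤ p * t ^ 2 := by
    refine mul_le_mul_of_nonneg_right ?_ (sq_nonneg t)
    nlinarith
  nlinarith

/-- The cluster bound beats the loss of the greedy construction, which has about `y ^ 2` steps and
loses a factor of order `log y ^ 2` in each of them, where `y = log t`. -/
theorem eventually_exp_mul_pow_le {c a : ℝ} (hc : 0 < c) (ha : 0 < a) :
    ∀ᶠ y : ℝ in Filter.atTop, 12 * y ≤ c * Real.exp y ∧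
      2 * Real.exp (-((c * (1 / y) * Real.exp y / 8) ^ 2 / 2))
        * (4 * Real.log y ^ 2) ^ (⌈y ^ 2 / (2 * a)⌉₊ + 1) ≤ 1 / Real.log y := by
  have hκ : 0 < min (c / 12) (c ^ 2 / 128 / (10 + 2 / a)) := by positivity
  have hlim := (Real.tendsto_pow_mul_exp_neg_atTop_nhds_zero 5).eventually_lt_const hκ
  filter_upwards [hlim, Filter.eventually_ge_atTop (Real.exp 1)] with y hy hye
  have he := Real.exp_one_gt_d9
  have hy1 : 1 ≤ y := by linarith
  have hy0 : 0 < y := by linarith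
  rw [Real.exp_neg, ← div_eq_mul_inv, div_lt_iff₀ (Real.exp_pos y)] at hy
  have hE1 : y ^ 5 ≤ c / 12 * Real.exp y :=
    hy.le.trans (mul_le_mul_of_nonneg_right (min_le_left _ _) (Real.exp_pos _).le)
  have hE2 : y ^ 5 ≤ c ^ 2 / 128 / (10 + 2 / a) * Real.exp y :=
    hy.le.trans (mul_le_mul_of_nonneg_right (min_le_right _ _) (Real.exp_pos _).le)
  have hy5 : y ≤ y ^ 5 := le_self_pow₀ hy1 (by norm_num)
  refine ⟨by linarith, ?_⟩
  have hL1 : 1 ≤ Real.log y := by rwa [Real.le_log_iff_exp_le hy0]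
  have hLy : Real.log y ≤ y := (Real.log_le_sub_one_of_pos hy0).trans (by linarith)
  set m := ⌈y ^ 2 / (2 * a)⌉₊ + 1 with hm
  have hmle : (m : ℝ) ≤ y ^ 2 / (2 * a) + 2 := by
    have := (Nat.ceil_lt_add_one (by positivity : (0 : ℝ) ≤ y ^ 2 / (2 * a))).le
    rw [hm]; push_cast; linarith
  have h1 : 4 * Real.log y ^ 2 ≤ Real.exp (4 * y) := by
    have h2 : 2 * y ≤ Real.exp (2 * y) := by linarith [Real.add_one_le_exp (2 * y)]
    have h3 : Real.exp (4 * y) = Real.exp (2 * y) ^ 2 := by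
      rw [← Real.exp_nat_mul]; congr 1; push_cast; ring
    rw [h3]
    calc 4 * Real.log y ^ 2 = (2 * Real.log y) ^ 2 := by ring
      _ ≤ _ := pow_le_pow_left₀ (by linarith) (by linarith) 2
  have h4 : (4 * Real.log y ^ 2) ^ m ≤ Real.exp (4 * y * m) := by
    rw [mul_comm (4 * y) (m : ℝ), Real.exp_nat_mul]
    exact pow_le_pow_left₀ (by positivity) h1 m
  have h5 : (2 : ℝ) ≤ Real.exp 1 := by linarith
  have h6 : Real.log y ≤ Real.exp y := hLy.trans (by linarith [Real.add_one_le_exp y])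
  rw [le_div_iff₀ (by linarith)]
  have h7 : (10 + 2 / a) * y ^ 5 ≤ c ^ 2 / 128 * Real.exp (2 * y) := by
    have h8 : (10 + 2 / a) * y ^ 5 ≤ c ^ 2 / 128 * Real.exp y := by
      calc (10 + 2 / a) * y ^ 5 ≤ (10 + 2 / a) * (c ^ 2 / 128 / (10 + 2 / a) * Real.exp y) :=
            mul_le_mul_of_nonneg_left hE2 (by positivity)
        _ = _ := by field_simp
    refine h8.trans (mul_le_mul_of_nonneg_left (Real.exp_le_exp.2 (by linarith)) (by positivity))
  have h9 : 1 + 4 * y * m + y ≤ (c * (1 / y) * Real.exp y / 8) ^ 2 / 2 := by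
    have e : (c * (1 / y) * Real.exp y / 8) ^ 2 / 2 = c ^ 2 / 128 * Real.exp (2 * y) / y ^ 2 := by
      rw [two_mul y, Real.exp_add]; field_simp; norm_num
    rw [e, le_div_iff₀ (by positivity)]
    refine le_trans ?_ h7
    have hb : 1 + 4 * y * m + y ≤ (10 + 2 / a) * y ^ 3 := by
      have h10 : 4 * y * m ≤ 4 * y * (y ^ 2 / (2 * a) + 2) :=
        mul_le_mul_of_nonneg_left hmle (by linarith)
      have h11 : 4 * y * (y ^ 2 / (2 * a) + 2) = 2 / a * y ^ 3 + 8 * y := by field_simp; ring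
      have h12 : y ≤ y ^ 3 := le_self_pow₀ hy1 (by norm_num)
      linarith
    calc (1 + 4 * y * m + y) * y ^ 2 ≤ ((10 + 2 / a) * y ^ 3) * y ^ 2 :=
          mul_le_mul_of_nonneg_right hb (sq_nonneg y)
      _ = _ := by ring
  calc 2 * Real.exp (-((c * (1 / y) * Real.exp y / 8) ^ 2 / 2)) * (4 * Real.log y ^ 2) ^ m
        * Real.log y
      ≤ Real.exp 1 * Real.exp (-((c * (1 / y) * Real.exp y / 8) ^ 2 / 2)) * Real.exp (4 * y * m)
        * Real.exp y := by gcongr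
    _ = Real.exp (1 + 4 * y * m + y - (c * (1 / y) * Real.exp y / 8) ^ 2 / 2) := by
        rw [← Real.exp_add, ← Real.exp_add, ← Real.exp_add]; congr 1; ring
    _ ≤ 1 := by rw [Real.exp_le_one_iff]; linarith

/-- The part of the argument that needs `t` large in terms of `c`: in a family of at most
`exp (3 * (1 + c) * (t ^ 2 / 2 + 2 * t))` unit vectors whose weights obey the packing inequality at
`√3 * t`, the members with weight `1 / (2 * L ^ 2)` of other members at correlation above
`c / (1 + c) * (1 + C / log t)` have total weight at most `1 / L`, where `L = log (log t)`. -/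
theorem exists_weight_clustered_le (c : ℝ) (hc : 0 < c) :
    ∃ t₀ : ℝ, Real.exp (Real.exp 1) ≤ t₀ ∧ ∀ t, t₀ ≤ t → ∀ C : ℝ, 4 ≤ C →
      ∀ {ι : Type} {d : ℕ} (N A : Finset ι) (x : ι → Vec d) (w : ι → ℝ), (∀ i, 0 ≤ w i) →
      (∀ i ∈ N, ‖x i‖ = 1) → ∑ k ∈ N, w k ≤ 1 →
      (N.card : ℝ) ≤ Real.exp (3 * (1 + c) * (t ^ 2 / 2 + 2 * t)) →
      (∀ J ⊆ N, ∑ k ∈ J, w k ≤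
        (stdGaussian (Vec d)).real {r | ∃ k ∈ J, Real.sqrt 3 * t ≤ inner ℝ r (x k)}) →
      A ⊆ N →
      (∀ y ∈ A, 1 / (2 * Real.log (Real.log t) ^ 2) ≤
        ∑ k ∈ N with c / (1 + c) * (1 + C / Real.log t) < inner ℝ (x y) (x k), w k) →
      ∑ y ∈ A, w y ≤ 1 / Real.log (Real.log t) := by
  set a := c / (1 + c) with ha_def
  have hc1 : 0 < 1 + c := by linarith
  have ha : 0 < a := by positivity
  have hev := Real.tendsto_log_atTop.eventually (eventually_exp_mul_pow_le hc ha)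
  obtain ⟨t₁, ht₁⟩ := Filter.eventually_atTop.1 hev
  refine ⟨max t₁ (Real.exp (Real.exp 1)), le_max_right _ _, ?_⟩
  intro t ht C hC ι d N A x w hw hx hN hcard hpack hAN hA
  obtain ⟨hbig, hpow⟩ := ht₁ t ((le_max_left _ _).trans ht)
  have hte : Real.exp (Real.exp 1) ≤ t := (le_max_right _ _).trans ht
  have ht0 : 0 < t := (Real.exp_pos _).trans_le hte
  have hye : Real.exp 1 ≤ Real.log t := (Real.le_log_iff_exp_le ht0).2 hte
  set y := Real.log t with hy_def
  have hy1 : 1 < y := by linarith [Real.exp_one_gt_d9]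
  have hy0 : 0 < y := by linarith
  have hL1 : 1 ≤ Real.log y := (Real.le_log_iff_exp_le hy0).2 hye
  set L := Real.log y with hL_def
  rw [Real.exp_log ht0] at hbig hpow
  have hL0 : 0 < L := by linarith
  set ℓ := 1 / y with hℓ_def
  have hℓ : 0 < ℓ := by positivity
  have hℓ1 : ℓ ≤ 1 := by rw [hℓ_def, div_le_one hy0]; linarith
  -- At correlation above `1` there are no pairs of unit vectors, so `A` is empty.
  have hαpos : 0 < 1 / (2 * L ^ 2) := by positivity
  by_cases hρ1 : 1 ≤ a * (1 + C / y)
  · rcases A.eq_empty_or_nonempty with rfl | ⟨z, hz⟩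
    · simp only [Finset.sum_empty]; positivity
    · exfalso
      have h1 := hA z hz
      rw [Finset.sum_eq_zero] at h1
      · linarith
      · intro k hk
        rw [Finset.mem_filter] at hk
        have := real_inner_le_norm (x z) (x k)
        rw [hx z (hAN hz), hx k hk.1] at this
        linarith [hk.2]
  push Not at hρ1
  have hCℓ : 1 + 4 * ℓ ≤ 1 + C / y := by
    have : 4 * ℓ ≤ C / y := by
      rw [hℓ_def, mul_one_div]; exact div_le_div_of_nonneg_right hC hy0.le
    linarith
  have hρ : a * (1 + 4 * ℓ) ≤ a * (1 + C / y) := mul_le_mul_of_nonneg_left hCℓ ha.le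
  have haℓ : 0 < a * ℓ := mul_pos ha hℓ
  set σ := Real.sqrt (a * (1 + ℓ)) with hσ_def
  have hσ0 : 0 < σ := Real.sqrt_pos.2 (by positivity)
  have hσ2 : σ ^ 2 = a * (1 + ℓ) := Real.sq_sqrt (by positivity)
  have hσ1 : σ ^ 2 < 1 := by
    rw [hσ2]
    have e : a * (1 + 4 * ℓ) = a * (1 + ℓ) + 3 * (a * ℓ) := by ring
    linarith only [e, haℓ, hρ, hρ1]
  set h := c * ℓ * t / 8 with hh_def
  have hh0 : 0 ≤ h := by positivity
  have hcℓ : c * ℓ < 1 := by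
    have e1 : 1 - σ ^ 2 = (1 - c * ℓ) / (1 + c) := by rw [hσ2, ha_def]; field_simp; ring
    have : 0 < (1 - c * ℓ) / (1 + c) := by rw [← e1]; linarith
    linarith [(div_pos_iff_of_pos_right hc1).1 this]
  have hs1 : 1 ≤ Real.sqrt 3 := by
    rw [Real.one_le_sqrt]; norm_num
  have hhs : h ≤ Real.sqrt 3 * t := by
    have h1 : c * ℓ * t ≤ 1 * t := mul_le_mul_of_nonneg_right hcℓ.le ht0.le
    have h2 : 1 * t ≤ Real.sqrt 3 * t := mul_le_mul_of_nonneg_right hs1 ht0.le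
    rw [hh_def]; linarith
  have hbig' : 12 ≤ c * ℓ * t := by
    rw [hℓ_def, mul_one_div, div_mul_eq_mul_div, le_div_iff₀ hy0]
    exact hbig
  set τ := 2 * Real.exp (-(h ^ 2 / 2)) with hτ_def
  have hcluster : ∀ S : Vec d, ∑ k ∈ N with σ * ‖S‖ < inner ℝ (x k) S, w k ≤ τ := by
    intro S
    refine (hpack _ (Finset.filter_subset _ _)).trans ?_
    refine (stdGaussian_exists_clustered_le _ x S hσ0.le hσ1 hh0 hhs
      (fun k hk => hx k (Finset.mem_filter.1 hk).1)
      (fun k hk => (Finset.mem_filter.1 hk).2)).trans ?_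
    refine le_of_le_of_eq ?_ (two_mul (Real.exp (-(h ^ 2 / 2)))).symm
    refine add_le_add le_rfl (le_trans ?_
      (exp_mul_exp_clustered_le hc hℓ ht0 hσ2 hσ1 hbig'))
    refine mul_le_mul_of_nonneg_right (le_trans ?_ hcard) (Real.exp_pos _).le
    exact_mod_cast Finset.card_filter_le _ _
  set m := ⌈y ^ 2 / (2 * a)⌉₊ + 1 with hm_def
  have hmpos : (y ^ 2 / (2 * a) : ℝ) < m := by
    rw [hm_def]; push_cast
    linarith [Nat.le_ceil (y ^ 2 / (2 * a))]
  have hτ0 : 0 < τ := by positivity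
  -- The choice of `m` makes the main term `m * a * ℓ` exceed the start-up cost `1 / (2 * ℓ)`.
  have hstep : σ ^ 2 * (1 + ℓ) * m + 1 / (2 * ℓ) < m * (a * (1 + C / y)) := by
    have h1 : 1 / (2 * ℓ) < a * ℓ * m := by
      have h2 : a * ℓ * (y ^ 2 / (2 * a)) < a * ℓ * m := mul_lt_mul_of_pos_left hmpos haℓ
      have h3 : a * ℓ * (y ^ 2 / (2 * a)) = 1 / (2 * ℓ) := by rw [hℓ_def]; field_simp
      rwa [h3] at h2
    have h4 : (m : ℝ) * (a * (1 + 4 * ℓ)) ≤ m * (a * (1 + C / y)) :=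
      mul_le_mul_of_nonneg_left hρ (Nat.cast_nonneg m)
    have h5 : σ ^ 2 * (1 + ℓ) * m ≤ a * (1 + 3 * ℓ) * m := by
      refine mul_le_mul_of_nonneg_right ?_ (Nat.cast_nonneg m)
      rw [hσ2, mul_assoc]
      refine mul_le_mul_of_nonneg_left ?_ ha.le
      have h6 : ℓ * ℓ ≤ 1 * ℓ := mul_le_mul_of_nonneg_right hℓ1 hℓ.le
      linarith
    have h7 : (m : ℝ) * (a * (1 + 4 * ℓ)) = a * (1 + 3 * ℓ) * m + a * ℓ * m := by ring
    rw [h7] at h4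
    exact (add_lt_add_of_le_of_lt h5 h1).trans_le h4
  have hb1 : 1 ≤ 4 * L ^ 2 := by
    have := one_le_pow₀ (n := 2) hL1
    linarith only [this]
  have hτL : τ * (4 * L ^ 2) ^ m ≤ 1 / L := hpow
  have hL1' : 1 / L ≤ 1 := by rw [div_le_one hL0]; exact hL1
  have hτα : τ ≤ 1 / (4 * L ^ 2) := by
    rw [le_div_iff₀ (by positivity)]
    have : τ * (4 * L ^ 2) ≤ τ * (4 * L ^ 2) ^ m :=
      mul_le_mul_of_nonneg_left (le_self_pow₀ hb1 (by rw [hm_def]; omega)) hτ0.le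
    linarith
  have hhalf : 1 / (2 * L ^ 2) = 2 * (1 / (4 * L ^ 2)) := by field_simp; norm_num
  have h4pos : 0 < 1 / (4 * L ^ 2) := by positivity
  have hfin := weight_clustered_le hw hAN hx hN hσ0 hℓ (α := 1 / (2 * L ^ 2)) (by linarith)
    hcluster (ρ := a * (1 + C / y)) (fun z hz => (hA z hz).trans
      (Finset.sum_le_sum_of_subset_of_nonneg
        (Finset.monotone_filter_right _ fun k _ hk => le_of_lt hk) fun k _ _ => hw k)) m hstep
  have hwA : 0 ≤ ∑ z ∈ A, w z := Finset.sum_nonneg fun z _ => hw z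
  have h6 : (1 / (4 * L ^ 2)) ^ m * ∑ z ∈ A, w z ≤ τ := by
    refine le_trans (mul_le_mul_of_nonneg_right ?_ hwA) hfin
    exact pow_le_pow_left₀ h4pos.le (by linarith) m
  have h7 : ∑ z ∈ A, w z ≤ τ * (4 * L ^ 2) ^ m := by
    rw [one_div, inv_pow, inv_mul_le_iff₀ (by positivity)] at h6
    linarith
  exact h7.trans hτL

/-! ### Runs of the algorithm -/

section Coloring

variable {V : Type*} {d : ℕ} {G : SimpleGraph V} {v : V → Vec d}

theorem orthDir_eq_of_adj (hv : IsStrictVectorColoring G 3 v) {i j : V} (h : G.Adj i j) :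
    orthDir v i j = (2 / Real.sqrt 3) • (v j + (1 / 2 : ℝ) • v i) := by
  have hin : inner ℝ (v i) (v j) = (-(1 / 2) : ℝ) := by
    rw [hv.inner_eq i j h]; norm_num
  have e : v j - (inner ℝ (v i) (v j) : ℝ) • v i = v j + (1 / 2 : ℝ) • v i := by
    rw [hin, neg_smul, sub_neg_eq_add]
  have hn : ‖v j + (1 / 2 : ℝ) • v i‖ = Real.sqrt 3 / 2 := by
    have h1 : ‖v j + (1 / 2 : ℝ) • v i‖ ^ 2 = (Real.sqrt 3 / 2) ^ 2 := by
      rw [norm_add_sq_real, inner_smul_right, norm_smul, hv.norm_eq_one, hv.norm_eq_one,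
        real_inner_comm, hin, div_pow, Real.sq_sqrt (by norm_num)]
      norm_num
    exact (pow_left_inj₀ (norm_nonneg _) (by positivity) two_ne_zero).1 h1
  rw [orthDir, e, hn, inv_div]

theorem inner_orthDir_of_adj (hv : IsStrictVectorColoring G 3 v) {i j : V} (h : G.Adj i j) :
    inner ℝ (v i) (orthDir v i j) = (0 : ℝ) := by
  rw [orthDir_eq_of_adj hv h, inner_smul_right, inner_add_right, inner_smul_right,
    real_inner_self_eq_norm_sq, hv.norm_eq_one, hv.inner_eq i j h]
  norm_num

theorem norm_orthDir_of_adj (hv : IsStrictVectorColoring G 3 v) {i j : V} (h : G.Adj i j) :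
    ‖orthDir v i j‖ = 1 := by
  have h1 : ‖orthDir v i j‖ ^ 2 = 1 := by
    rw [orthDir_eq_of_adj hv h, norm_smul, mul_pow, norm_add_sq_real, inner_smul_right, norm_smul,
      hv.norm_eq_one, hv.norm_eq_one, real_inner_comm, hv.inner_eq i j h, Real.norm_eq_abs, sq_abs,
      div_pow, Real.sq_sqrt (by norm_num)]
    norm_num
  exact (pow_eq_one_iff_of_nonneg (norm_nonneg _) two_ne_zero).1 h1

/-- If both ends of an edge are selected, then the Gaussian vector has inner product at least
`√3 * t` with the direction of the edge: `t + t / 2 = (√3 / 2) * (√3 * t)`. -/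
theorem sqrt_three_mul_le_inner_orthDir (hv : IsStrictVectorColoring G 3 v) {i j : V}
    (h : G.Adj i j) {t : ℝ} {r : Vec d} (hi : i ∈ selected v t r) (hj : j ∈ selected v t r) :
    Real.sqrt 3 * t ≤ inner ℝ r (orthDir v i j) := by
  have hi' : t ≤ inner ℝ r (v i) := hi
  have hj' : t ≤ inner ℝ r (v j) := hj
  rw [orthDir_eq_of_adj hv h, inner_smul_right, inner_add_right, inner_smul_right]
  have hs : 0 < Real.sqrt 3 := Real.sqrt_pos.2 (by norm_num)
  rw [div_mul_eq_mul_div, le_div_iff₀ hs]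
  have := Real.mul_self_sqrt (show (0 : ℝ) ≤ 3 by norm_num)
  have e : Real.sqrt 3 * t * Real.sqrt 3 = 3 * t := by rw [mul_right_comm, this]
  rw [e]
  linarith

theorem stdGaussian_real_selected (hv : IsStrictVectorColoring G 3 v) (t : ℝ) (i : V) :
    (stdGaussian (Vec d)).real {r | t ≤ inner ℝ r (v i)} = gaussianTail t := by
  have h := map_inner_stdGaussian (v i)
  rw [hv.norm_eq_one, one_pow, Real.toNNReal_one] at h
  have := nullSingletonClass_gaussianReal (μ := 0) (v := 1) one_ne_zero
  rw [gaussianTail_eq_real, measureReal_congr (Ioi_ae_eq_Ici (μ := gaussianReal 0 1) (a := t)), ← h,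
    map_measureReal_apply (measurable_inner_right _) measurableSet_Ici]
  rfl

end Coloring

namespace IsKMSPrimeRun

variable {V : Type*} {d : ℕ} {G : SimpleGraph V} {v : V → Vec d} {t : ℝ} {Ω : Type*}
  [MeasurableSpace Ω] {P : Measure Ω} {r : Ω → Vec d} {M : Ω → G.Subgraph}

theorem isProbabilityMeasure (h : IsKMSPrimeRun G v t P r M) : IsProbabilityMeasure P := by
  have h1 : IsProbabilityMeasure (P.map r) := by rw [h.law_r]; infer_instance
  exact Measure.isProbabilityMeasure_of_map r

theorem selected_of_adj (h : IsKMSPrimeRun G v t P r M) {ω : Ω} {i j : V} (hij : (M ω).Adj i j) :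
    i ∈ selected v t (r ω) :=
  (h.maximal ω).1.2 ((M ω).edge_vert hij)

theorem measurableSet_selected (h : IsKMSPrimeRun G v t P r M) (i : V) :
    MeasurableSet {ω | i ∈ selected v t (r ω)} :=
  h.measurable_r (measurableSet_le measurable_const (measurable_inner_right (v i)))

theorem real_selected (h : IsKMSPrimeRun G v t P r M) (hv : IsStrictVectorColoring G 3 v) (i : V) :
    P.real {ω | i ∈ selected v t (r ω)} = gaussianTail t := by
  rw [← stdGaussian_real_selected hv t i, ← h.law_r, map_measureReal_apply h.measurable_r]
  · rfl
  · exact measurableSet_le measurable_const (measurable_inner_right (v i))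

theorem cond_real (h : IsKMSPrimeRun G v t P r M) (hv : IsStrictVectorColoring G 3 v) (i : V)
    {s : Set Ω} (hs : s ⊆ {ω | i ∈ selected v t (r ω)}) :
    (cond P {ω | i ∈ selected v t (r ω)}).real s = P.real s / gaussianTail t := by
  rw [measureReal_def, cond_apply (h.measurableSet_selected i), Set.inter_eq_self_of_subset_right hs,
    ENNReal.toReal_mul, ENNReal.toReal_inv, ← h.real_selected hv i, div_eq_inv_mul]
  rfl

theorem edgeWeight_eq (h : IsKMSPrimeRun G v t P r M) (hv : IsStrictVectorColoring G 3 v) (i j : V) :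
    edgeWeight v t P r M i j = P.real {ω | (M ω).Adj i j} / gaussianTail t :=
  h.cond_real hv i fun _ hω => h.selected_of_adj hω

theorem edgeWeight_comm (h : IsKMSPrimeRun G v t P r M) (hv : IsStrictVectorColoring G 3 v)
    (i j : V) : edgeWeight v t P r M i j = edgeWeight v t P r M j i := by
  rw [h.edgeWeight_eq hv, h.edgeWeight_eq hv]
  congr 2
  ext ω
  exact (M ω).adj_comm i j

theorem edgeWeight_nonneg (i j : V) : 0 ≤ edgeWeight v t P r M i j := measureReal_nonneg

/-- In a matching at most one of the events `{i, j} ∈ M` occurs for a given `i`. -/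
theorem sum_edgeWeight (h : IsKMSPrimeRun G v t P r M) (i : V) (J : Finset V) :
    ∑ j ∈ J, edgeWeight v t P r M i j
      = (cond P {ω | i ∈ selected v t (r ω)}).real {ω | ∃ j ∈ J, (M ω).Adj i j} := by
  have := h.isProbabilityMeasure
  have e : {ω | ∃ j ∈ J, (M ω).Adj i j} = ⋃ j ∈ J, {ω | (M ω).Adj i j} := by
    ext ω; simp
  rw [e, measureReal_biUnion_finset]
  · rfl
  · intro j _ k _ hjk
    refine Set.disjoint_left.2 fun ω hj hk => hjk ?_
    have hj' : (M ω).Adj i j := hj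
    exact ((h.maximal ω).1.1 ((M ω).edge_vert hj')).unique hj hk
  · exact fun j _ => h.measurable_M i j

theorem removalProb_eq_sum [Fintype V] (h : IsKMSPrimeRun G v t P r M) (i : V) :
    removalProb v t P r M i = ∑ j ∈ nbrs (⊤ : G.Subgraph) i, edgeWeight v t P r M i j := by
  rw [h.sum_edgeWeight, removalProb]
  congr 1
  ext ω
  simp only [Set.mem_ofPred_eq, mem_nbrs, SimpleGraph.Subgraph.top_adj]
  constructor
  · intro hi
    obtain ⟨j, hj, _⟩ := (h.maximal ω).1.1 hi
    exact ⟨j, (M ω).adj_sub hj, hj⟩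
  · rintro ⟨j, _, hj⟩
    exact (M ω).edge_vert hj

theorem sum_edgeWeight_le_one (h : IsKMSPrimeRun G v t P r M) (i : V) (J : Finset V) :
    ∑ j ∈ J, edgeWeight v t P r M i j ≤ 1 := by
  rw [h.sum_edgeWeight]
  exact measureReal_le_one

/-- The packing inequality. An edge of `M` at `j` forces the Gaussian vector to have a large
component along the direction of the edge, and these directions are orthogonal to `v j`, so the
conditioning on the selection of `j` does not matter. -/
theorem sum_edgeWeight_le (h : IsKMSPrimeRun G v t P r M) (hv : IsStrictVectorColoring G 3 v)
    (ht : 0 < gaussianTail t) (j : V) (J : Finset V) (hJ : ∀ k ∈ J, G.Adj j k) :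
    ∑ k ∈ J, edgeWeight v t P r M j k ≤
      (stdGaussian (Vec d)).real {x | ∃ k ∈ J, Real.sqrt 3 * t ≤ inner ℝ x (orthDir v j k)} := by
  have := h.isProbabilityMeasure
  set E : Set (Vec d) := {x | ∃ k ∈ J, Real.sqrt 3 * t ≤ inner ℝ x (orthDir v j k)} with hE
  have hEm : MeasurableSet E := by
    have : E = ⋃ k ∈ J, {x | Real.sqrt 3 * t ≤ inner ℝ x (orthDir v j k)} := by
      ext x; simp [hE]
    rw [this]
    exact Finset.measurableSet_biUnion J fun k _ =>
      measurableSet_le measurable_const (measurable_inner_right _)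
  have hproj : (fun x : Vec d => x - (inner ℝ x (v j) : ℝ) • v j) ⁻¹' E = E := by
    ext x
    simp only [hE, Set.mem_preimage, Set.mem_ofPred_eq]
    refine exists_congr fun k => and_congr_right fun hk => ?_
    rw [inner_sub_left, inner_smul_left, inner_orthDir_of_adj hv (hJ k hk)]
    simp
  have hind := (indepFun_inner_sub_proj (hv.norm_eq_one j)).measure_inter_preimage_eq_mul
    (Set.Ici t) E measurableSet_Ici hEm
  rw [hproj] at hind
  have hsel : MeasurableSet ((fun x : Vec d => (inner ℝ x (v j) : ℝ)) ⁻¹' Set.Ici t) :=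
    measurable_inner_right _ measurableSet_Ici
  have hreal : (stdGaussian (Vec d)).real
      ((fun x : Vec d => (inner ℝ x (v j) : ℝ)) ⁻¹' Set.Ici t ∩ E)
      = gaussianTail t * (stdGaussian (Vec d)).real E := by
    rw [measureReal_def, hind, ENNReal.toReal_mul, ← stdGaussian_real_selected hv t j]
    rfl
  rw [h.sum_edgeWeight, h.cond_real hv j, div_le_iff₀' ht, ← hreal, ← h.law_r,
    map_measureReal_apply h.measurable_r (hsel.inter hEm)]
  · refine measureReal_mono ?_
    rintro ω ⟨k, hk, hadj⟩
    exact ⟨h.selected_of_adj hadj, k, hk, sqrt_three_mul_le_inner_orthDir hv (hJ k hk)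
      (h.selected_of_adj hadj) (h.selected_of_adj hadj.symm)⟩
  · rintro ω ⟨k, hk, hadj⟩
    exact h.selected_of_adj hadj

/-- Failure of the algorithm in terms of the edge weights. -/
theorem card_le_totalWeight [Fintype V] (h : IsKMSPrimeRun G v t P r M)
    (hfail : KMSPrimeFails v t P r M) :
    (Fintype.card V : ℝ) / 4 ≤ totalWeight (edgeWeight v t P r M) (⊤ : G.Subgraph) := by
  classical
  have h1 : ∀ i, (if 1 / 2 ≤ removalProb v t P r M i then (1 / 2 : ℝ) else 0)
      ≤ ∑ j ∈ nbrs (⊤ : G.Subgraph) i, edgeWeight v t P r M i j := by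
    intro i
    rw [← h.removalProb_eq_sum]
    split_ifs with hi
    · exact hi
    · exact measureReal_nonneg
  refine le_trans ?_ (Finset.sum_le_sum fun i _ => h1 i)
  rw [← Finset.sum_filter, Finset.sum_const, nsmul_eq_mul]
  unfold KMSPrimeFails at hfail
  rw [Set.ncard_eq_toFinset_card', Set.toFinset_ofPred] at hfail
  linarith

end IsKMSPrimeRun

/-! ### The two-step neighborhoods -/

/-- The weight that a vertex can reject. Members with many close members weigh at most `1 / L` in
total. For the others, weight below `1 / (2 * L ^ 2)` at middle correlation means weight below
`1 / L ^ 2` at correlation at least `-1 / L`, so they are covered by at most `L + 1` light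
neighborhoods. -/
theorem sum_rejected_le {ι E : Type*} [NormedAddCommGroup E]
    [InnerProductSpace ℝ E] {w : ι → ℝ} (hw : ∀ i, 0 ≤ w i) {N D : Finset ι} {x : ι → E}
    {L ρ : ℝ} (hL : 1 ≤ L) (hDN : D ⊆ N) (hx : ∀ i ∈ N, ‖x i‖ = 1)
    (hclose : ∀ A ⊆ N, (∀ y ∈ A, 1 / (2 * L ^ 2) ≤
      ∑ k ∈ N with ρ < inner ℝ (x y) (x k), w k) → ∑ y ∈ A, w y ≤ 1 / L)
    (hsparse : ∀ D' ⊆ D, D'.Nonempty → ∃ i ∈ D',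
      ∑ k ∈ D' with (-(1 / L) ≤ inner ℝ (x i) (x k) ∧ inner ℝ (x i) (x k) ≤ ρ), w k
        < 1 / (2 * L ^ 2)) :
    ∑ i ∈ D, w i ≤ 3 / L := by
  classical
  have hL0 : 0 < L := by linarith
  rw [← Finset.sum_filter_add_sum_filter_not D fun y => 1 / (2 * L ^ 2) ≤
    ∑ k ∈ N with ρ < inner ℝ (x y) (x k), w k]
  have h1 := hclose (D.filter fun y => 1 / (2 * L ^ 2) ≤
    ∑ k ∈ N with ρ < inner ℝ (x y) (x k), w k) ((Finset.filter_subset _ _).trans hDN)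
    fun y hy => (Finset.mem_filter.1 hy).2
  obtain ⟨I, hI, hsep, hle⟩ := exists_separated_of_sparse (w := w) (δ := 1 / L ^ 2)
    (near := fun i k => -(1 / L) ≤ inner ℝ (x i) (x k))
    (D.filter fun y => ¬ 1 / (2 * L ^ 2) ≤ ∑ k ∈ N with ρ < inner ℝ (x y) (x k), w k)
    (fun i => le_trans (by rw [neg_nonpos]; positivity) real_inner_self_nonneg) (by
      intro D' hD' hne
      have hD'D := hD'.trans (Finset.filter_subset _ _)
      obtain ⟨i, hi, hlt⟩ := hsparse D' hD'D hne
      refine ⟨i, hi, fun F hF hnear => ?_⟩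
      have hfar := (Finset.mem_filter.1 (hD' hi)).2
      push Not at hfar
      rw [← Finset.sum_filter_add_sum_filter_not F fun k => ρ < inner ℝ (x i) (x k)]
      have h2 : ∑ k ∈ F with ρ < inner ℝ (x i) (x k), w k
          ≤ ∑ k ∈ N with ρ < inner ℝ (x i) (x k), w k :=
        Finset.sum_le_sum_of_subset_of_nonneg
          (Finset.filter_subset_filter _ ((hF.trans hD'D).trans hDN)) fun k _ _ => hw k
      have h3 : ∑ k ∈ F with ¬ ρ < inner ℝ (x i) (x k), w k
          ≤ ∑ k ∈ D' with (-(1 / L) ≤ inner ℝ (x i) (x k) ∧ inner ℝ (x i) (x k) ≤ ρ), w k := by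
        refine Finset.sum_le_sum_of_subset_of_nonneg (fun k hk => ?_) fun k _ _ => hw k
        rw [Finset.mem_filter, not_lt] at hk
        exact Finset.mem_filter.2 ⟨hF hk.1, hnear k hk.1, hk.2⟩
      have e : 1 / L ^ 2 = 1 / (2 * L ^ 2) + 1 / (2 * L ^ 2) := by field_simp; norm_num
      rw [e]
      linarith)
  have hcard := card_mul_le_of_pairwise_inner_lt (x := x) (ε := 1 / L) (by positivity) I
    (fun i hi => hx i (hDN ((Finset.filter_subset _ _) (hI hi))))
    (fun i hi k hk hik => by
      rcases hsep hi hk hik with h | h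
      · exact not_le.1 h
      · rw [real_inner_comm]; exact not_le.1 h)
  have h4 : (I.card : ℝ) * (1 / L ^ 2) ≤ 2 / L := by
    have h5 : (I.card : ℝ) * (1 / L) * (1 / L) ≤ (1 + 1 / L) * (1 / L) :=
      mul_le_mul_of_nonneg_right hcard (by positivity)
    have h6 : (1 + 1 / L) * (1 / L) ≤ (1 + 1) * (1 / L) := by
      have : 1 / L ≤ 1 := by rw [div_le_one hL0]; exact hL
      gcongr
    calc (I.card : ℝ) * (1 / L ^ 2) = (I.card : ℝ) * (1 / L) * (1 / L) := by field_simp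
      _ ≤ (1 + 1) * (1 / L) := h5.trans h6
      _ = 2 / L := by ring
  have e : 3 / L = 1 / L + 2 / L := by ring
  rw [e]
  linarith

/-- The degree bound contained in the inefficiency of `t`. -/
theorem card_nbrs_le {V : Type*} [Fintype V] {G : SimpleGraph V} {c t : ℝ} (hc : 0 < c)
    (ht : 2 ≤ t) (h : IsInefficientParam G c t) (j : V) :
    ((nbrs (⊤ : G.Subgraph) j).card : ℝ) ≤ Real.exp (3 * (1 + c) * (t ^ 2 / 2 + 2 * t)) := by
  classical
  have h1 : (nbrs (⊤ : G.Subgraph) j).card ≤ G.maxDegree := by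
    have e : nbrs (⊤ : G.Subgraph) j = G.neighborFinset j := by
      ext k; simp [mem_nbrs]
    rw [e, SimpleGraph.card_neighborFinset_eq_degree]
    exact G.degree_le_maxDegree j
  refine (Nat.cast_le.2 h1).trans ?_
  rcases Nat.eq_zero_or_pos G.maxDegree with h0 | hpos
  · rw [h0, Nat.cast_zero]; exact (Real.exp_pos _).le
  have hΔ : (0 : ℝ) < G.maxDegree := by exact_mod_cast hpos
  have h2 : Real.exp (-(t ^ 2 / 2 + 2 * t)) ≤ (G.maxDegree : ℝ) ^ (-(1 / (3 * (1 + c)))) := by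
    refine (exp_le_gaussianTail ht).trans (le_of_eq ?_)
    unfold IsInefficientParam at h
    convert h
  rw [Real.rpow_def_of_pos hΔ, Real.exp_le_exp] at h2
  rw [← Real.log_le_iff_le_exp hΔ]
  have hc1 : 0 < 3 * (1 + c) := by linarith
  have h3 : Real.log G.maxDegree / (3 * (1 + c)) ≤ t ^ 2 / 2 + 2 * t := by
    have : Real.log G.maxDegree * -(1 / (3 * (1 + c)))
        = -(Real.log G.maxDegree / (3 * (1 + c))) := by ring
    linarith
  rw [div_le_iff₀ hc1] at h3
  linarith

theorem sum_twoStep_eq {V : Type*} [Fintype V] {d : ℕ} {G : SimpleGraph V} (H : G.Subgraph)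
    (v : V → Vec d) (c C t : ℝ) (i j : V) (f : V → ℝ) :
    ∑ k ∈ twoStep H v c C t i j, f k =
      ∑ k ∈ nbrs H j with (-(1 / Real.log (Real.log t)) ≤ inner ℝ (orthDir v j i) (orthDir v j k) ∧
        inner ℝ (orthDir v j i) (orthDir v j k) ≤ c / (1 + c) * (1 + C / Real.log t)), f k := by
  unfold twoStep
  congr!

theorem mainTheorem5 :
    ∃ K : ℝ, 0 < K ∧ ∀ c : ℝ, 0 < c → ∃ C : ℝ, 0 < C ∧ ∃ n₀ : ℕ, ∀ n : ℕ, n₀ ≤ n →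
      ∀ (G : SimpleGraph (Fin n)) (d : ℕ) (v : Fin n → Vec d), IsStrictVectorColoring G 3 v →
      ∀ t : ℝ, Real.exp 1 < t → IsInefficientParam G c t →
      ∀ (Ω : Type*) [MeasurableSpace Ω] (P : Measure Ω) (r : Ω → Vec d) (M : Ω → G.Subgraph),
        IsKMSPrimeRun G v t P r M → KMSPrimeFails v t P r M →
        ∃ G' : G.Subgraph, G'.verts.Nonempty ∧ ∀ i ∈ G'.verts,
          1 / 8 - K / Real.log (Real.log t) ≤ ∑ j ∈ nbrs G' i, edgeWeight v t P r M i j ∧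
          ∀ j, G'.Adj i j →
            IsPacking (twoStep G' v c C t i j) (orthDir v j) (edgeWeight v t P r M j)
              (Real.sqrt 3 * t) (1 / (2 * Real.log (Real.log t) ^ 2)) := by
  refine ⟨4, by norm_num, fun c hc => ?_⟩
  obtain ⟨t₀, ht₀, hlarge⟩ := exists_weight_clustered_le c hc
  set a := c / (1 + c) with ha_def
  have ha : 0 < a := by positivity
  -- The second bound makes the upper limit of the correlations at least `1` for `t < t₀`.
  refine ⟨max 4 (1 / a * Real.log t₀), lt_of_lt_of_le (by norm_num) (le_max_left _ _), 1, ?_⟩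
  set C := max 4 (1 / a * Real.log t₀) with hC_def
  intro n hn G d v hv t hte hineff Ω _ P r M hrun hfail
  have ht0 : 0 < t := (Real.exp_pos 1).trans hte
  have ht2 : 2 ≤ t := by linarith [Real.exp_one_gt_d9]
  have hy1 : 1 < Real.log t := (Real.lt_log_iff_exp_lt ht0).2 hte
  have hL0 : 0 < Real.log (Real.log t) := Real.log_pos hy1
  have htail := gaussianTail_pos ht2
  have hnonneg : ∀ i j, 0 ≤ edgeWeight v t P r M i j := IsKMSPrimeRun.edgeWeight_nonneg
  set L := Real.log (Real.log t) with hL_def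
  rcases le_or_gt L 32 with hL32 | hL32
  · -- The required weighted degree is not positive, and an isolated vertex will do.
    have i₀ : Fin n := ⟨0, hn⟩
    refine ⟨G.singletonSubgraph i₀, ⟨i₀, rfl⟩, fun i _ => ⟨?_, fun j hij => ?_⟩⟩
    · refine le_trans ?_ (Finset.sum_nonneg fun j _ => hnonneg i j)
      rw [sub_nonpos, div_le_div_iff₀ (by norm_num) hL0]
      linarith
    · exact hij.elim
  have hL1 : 1 ≤ L := by linarith
  -- Few neighbors `i` of `j` have many neighbors of `j` above the allowed correlation.
  have hclose : ∀ j, ∀ A ⊆ nbrs (⊤ : G.Subgraph) j, (∀ y ∈ A, 1 / (2 * L ^ 2) ≤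
      ∑ k ∈ nbrs (⊤ : G.Subgraph) j with
        a * (1 + C / Real.log t) < inner ℝ (orthDir v j y) (orthDir v j k),
        edgeWeight v t P r M j k) → ∑ y ∈ A, edgeWeight v t P r M j y ≤ 1 / L := by
    intro j A hAN hA
    have hadj : ∀ k ∈ nbrs (⊤ : G.Subgraph) j, G.Adj j k := fun k hk => by
      simpa [mem_nbrs] using hk
    have hunit : ∀ k ∈ nbrs (⊤ : G.Subgraph) j, ‖orthDir v j k‖ = 1 := fun k hk =>
      norm_orthDir_of_adj hv (hadj k hk)
    rcases le_or_gt t₀ t with htt | htt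
    · exact hlarge t htt C (le_max_left _ _) _ A (orthDir v j) _ (hnonneg j) hunit
        (hrun.sum_edgeWeight_le_one j _) (card_nbrs_le hc ht2 hineff j)
        (fun J hJ => hrun.sum_edgeWeight_le hv htail j J fun k hk => hadj k (hJ hk)) hAN hA
    · rcases A.eq_empty_or_nonempty with rfl | ⟨z, hz⟩
      · rw [Finset.sum_empty]; positivity
      · exfalso
        have h1 := hA z hz
        have h2 : 0 < 1 / (2 * L ^ 2) := by positivity
        rw [Finset.sum_eq_zero] at h1
        · linarith
        · intro k hk
          rw [Finset.mem_filter] at hk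
          have h3 := real_inner_le_norm (orthDir v j z) (orthDir v j k)
          rw [hunit z (hAN hz), hunit k hk.1] at h3
          have h4 : Real.log t ≤ Real.log t₀ := Real.log_le_log ht0 htt.le
          have h5 : 1 / a ≤ C / Real.log t := by
            rw [le_div_iff₀ (by linarith)]
            exact (mul_le_mul_of_nonneg_left h4 (by positivity)).trans (le_max_right _ _)
          have h6 : a * (1 / a) ≤ a * (C / Real.log t) := mul_le_mul_of_nonneg_left h5 ha.le
          rw [mul_one_div_cancel ha.ne'] at h6
          linarith [hk.2]
  let mid : Fin n → Fin n → Fin n → Prop := fun j i k =>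
    -(1 / L) ≤ inner ℝ (orthDir v j i) (orthDir v j k) ∧
      inner ℝ (orthDir v j i) (orthDir v j k) ≤ a * (1 + C / Real.log t)
  classical
  let R : Fin n → Finset (Fin n) → Finset (Fin n) → Prop := fun j D N =>
    D ⊆ nbrs (⊤ : G.Subgraph) j ∧ Disjoint D N ∧ ∀ D' ⊆ D, D'.Nonempty → ∃ i ∈ D',
      ∑ k ∈ D' ∪ N with mid j i k, edgeWeight v t P r M j k < 1 / (2 * L ^ 2)
  have hmonoSum : ∀ j i (F F' : Finset (Fin n)), F ⊆ F' →
      ∑ k ∈ F with mid j i k, edgeWeight v t P r M j k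
        ≤ ∑ k ∈ F' with mid j i k, edgeWeight v t P r M j k := fun j i F F' hF =>
    Finset.sum_le_sum_of_subset_of_nonneg (Finset.filter_subset_filter _ hF)
      fun k _ _ => hnonneg j k
  obtain ⟨H, hne, hH⟩ := exists_pruned_subgraph (G := G) (w := edgeWeight v t P r M)
    (hrun.edgeWeight_comm hv) (θ := 1 / 8 - 4 / L) (B := 3 / L)
    (fun j N i => ∑ k ∈ N with mid j i k, edgeWeight v t P r M j k < 1 / (2 * L ^ 2)) R
    (fun j N => ⟨Finset.empty_subset _, Finset.disjoint_empty_left _, fun D' hD' hne' => by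
      rw [Finset.subset_empty.1 hD'] at hne'
      exact absurd hne' Finset.not_nonempty_empty⟩)
    (fun j D N N' hN' ⟨hD, hdisj, hsp⟩ => ⟨hD, hdisj.mono_right hN', fun D' hD' hne' => by
      obtain ⟨i, hi, hlt⟩ := hsp D' hD' hne'
      exact ⟨i, hi, (hmonoSum j i _ _ (Finset.union_subset_union_right hN')).trans_lt hlt⟩⟩)
    (by
      rintro j D N i hNj ⟨hD, hdisj, hsp⟩ hi hbad
      have hiD : i ∉ D := fun h => Finset.disjoint_left.1 hdisj h hi
      refine ⟨hiD, Finset.insert_subset (hNj hi) hD, ?_, fun D' hD' hne' => ?_⟩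
      · rw [Finset.disjoint_insert_left]
        exact ⟨Finset.notMem_erase i N, hdisj.mono_right (Finset.erase_subset i N)⟩
      -- The earliest rejected member of `D'` saw all of `D'`; it is `i` only if `D' = {i}`.
      rcases (D'.erase i).eq_empty_or_nonempty with h0 | h0
      · have hD'i : D' ⊆ {i} := by
          rw [← insert_empty_eq, Finset.subset_insert_iff, h0]
        have hiD' : D' = {i} := (Finset.Nonempty.subset_singleton_iff hne').1 hD'i
        subst hiD'
        refine ⟨i, Finset.mem_singleton_self i, (hmonoSum j i _ _ ?_).trans_lt hbad⟩
        exact Finset.union_subset (Finset.singleton_subset_iff.2 hi) (Finset.erase_subset i N)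
      · obtain ⟨k, hk, hlt⟩ := hsp (D'.erase i) (Finset.subset_insert_iff.1 hD') h0
        refine ⟨k, Finset.mem_of_mem_erase hk, (hmonoSum j k _ _ ?_).trans_lt hlt⟩
        intro z hz
        rw [Finset.mem_union, Finset.mem_erase] at hz
        rw [Finset.mem_union, Finset.mem_erase]
        by_cases hzi : z = i
        · subst hzi; exact Or.inr hi
        · tauto)
    (by
      rintro j D N ⟨hD, -, hsp⟩
      refine sum_rejected_le (hnonneg j) hL1 hD
        (fun i hi => norm_orthDir_of_adj hv (by simpa [mem_nbrs] using hi)) (hclose j)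
        fun D' hD' hne' => ?_
      obtain ⟨i, hi, hlt⟩ := hsp D' hD' hne'
      refine ⟨i, hi, lt_of_le_of_lt ?_ hlt⟩
      convert hmonoSum j i _ _ Finset.subset_union_left)
    (by
      refine lt_of_lt_of_le ?_ (hrun.card_le_totalWeight hfail)
      rw [Fintype.card_fin]
      have hn0 : (0 : ℝ) < n := by exact_mod_cast hn
      have e : 2 * (1 / 8 - 4 / L + 3 / L) * (n : ℝ) = n / 4 - 2 * (n / L) := by ring
      rw [e]
      have : 0 < (n : ℝ) / L := by positivity
      linarith)
  refine ⟨H, hne, fun i hi => ⟨(hH i hi).1, fun j hij => ?_⟩⟩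
  have hadj : ∀ k ∈ twoStep H v c C t i j, G.Adj j k := by
    intro k hk
    unfold twoStep at hk
    exact H.adj_sub ((mem_nbrs H j k).1 (Finset.mem_filter.1 hk).1)
  refine ⟨fun k hk => norm_orthDir_of_adj hv (hadj k hk), fun k _ => hnonneg j k,
    fun J hJ => hrun.sum_edgeWeight_le hv htail j J fun k hk => hadj k (hJ hk), ?_⟩
  have := (hH i hi).2 j hij
  rw [not_lt] at this
  rw [sum_twoStep_eq]
  convert this
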